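/- Let $\varphi:[0,\infty)\to(0,\infty)$ be continuous, and suppose that for every $t\ge 0$ the function $\varphi_t$ given by $\varphi_t(x)=\sqrt{\varphi(x)/\varphi(x-t)}$ for $x\ge t$ and $\varphi_t(x)=0$ for $0\le x<t$ is essentially bounded. On $L^2(\mathbb R_+)$, $\mathbb R_+=[0,\infty)$ (complex valued functions, Lebesgue measure), let $S_t$ be the bounded operator $(S_tf)(x)=\varphi_t(x)f(x-t)$ for $x\ge t$ and $(S_tf)(x)=0$ for $x<t$. Assume that $\inf_{x\ge 0}\varphi(x+s)/\varphi(x)>0$ for every $s\ge 0$, and let $t>0$. Then $S_t$ is left invertible. Let $S_t'=S_t(S_t^*S_t)^{-1}$ be its Cauchy dual, $L_t=(S_t')^*$, $E=\ker S_t^*$, and let $D_r=\{z\in\mathbb C:|z|<r(L_t)^{-1}\}$, where $r(L_t)$ is the spectral radius of $L_t$. There exist a reproducing kernel Hilbert space $\mathcal H$ of $E$-valued analytic functions on $D_r$ (on which multiplication by $z$, $(\mathcal M_zh)(z)=z\,h(z)$, is a bounded operator $\mathcal M_z$) and a unitary operator $U:L^2(\mathbb R_+)\to\mathcal H$ such that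 $\mathcal M_zU=US_t$. Moreover $(Ue)(z)=e$ for all $e\in E$ and $z\in D_r$, and $U$ maps $E$ onto the subspace of all constant functions in $\mathcal H$. Let $k_{\mathcal H}:D_r\times D_r\to B(E)$ be the reproducing kernel of $\mathcal H$. Then: (i) for all $e\in E$ and $\lambda\in D_r$, $k_{\mathcal H}(\cdot,\lambda)e\in\mathcal H$, and $\langle (Uf)(\lambda),e\rangle_E=\langle Uf,k_{\mathcal H}(\cdot,\lambda)e\rangle_{\mathcal H}$ for every $f\in L^2(\mathbb R_+)$; (ii) for all $z,\lambda\in D_r$ the series $\sum_{n\ge0}\frac{\varphi(x)}{\varphi(x+nt)}z^n\bar\lambda^n$ converges absolutely for every $x\ge 0$, and for every $e\in E$ and almost every $x\ge0$, $$(k_{\mathcal H}(z,\lambda)e)(x)=\Big(\sum_{n=0}^\infty\frac{\varphi(x)}{\varphi(x+nt)}z^n\bar\lambda^n\Big)e(x);$$ (iii) every $E$-valued polynomial in $z$ belongs to $\mathcal H$, and the $E$-valued polynomials are dense in $\mathcal H$; (iv) $\mathcal H$ has an orthonormal basis consisting of $E$-valued polynomials in $z$, namely the functions $U\psi_{jk}$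 ($j\in\mathbb Z$, $k\in\mathbb Z_{\ge0}$), where $\psi_{jk}(x)=2^{j/2}\psi(2^jx-k)$ for $x\ge0$, and $\psi=1$ on $[0,\tfrac12)$, $\psi=-1$ on $[\tfrac12,1)$, $\psi=0$ elsewhere. -/

import Mathlib

open MeasureTheory Set
open scoped ENNReal InnerProductSpace ComplexConjugate

noncomputable section

namespace WTS

/-- Lebesgue measure on the half line `[0, ∞)`. -/
abbrev halfLine : Measure ℝ := volume.restrict (Ici (0 : ℝ))

/-- The complex Hilbert space `L²(ℝ₊)`. -/
abbrev L2 : Type := Lp ℂ 2 halfLine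

/-- The weight `φ_t`: `√(φ(x) / φ(x - t))` for `x ≥ t`, and `0` for `x < t`. -/
def weight (φ : ℝ → ℝ) (t x : ℝ) : ℝ :=
  if t ≤ x then Real.sqrt (φ x / φ (x - t)) else 0

/-- A symbol: a continuous positive function on `[0, ∞)` all of whose weights `φ_t`, `t ≥ 0`,
are essentially bounded (only the values of `φ` on `[0, ∞)` matter). -/
structure IsSymbol (φ : ℝ → ℝ) : Prop where
  continuousOn : ContinuousOn φ (Ici 0)
  pos : ∀ x, 0 ≤ x → 0 < φ x
  essBounded : ∀ t, 0 ≤ t → ∃ M : ℝ, ∀ᵐ x ∂halfLine, weight φ t x ≤ M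

/-- The function `x ↦ φ_t(x) f(x - t)` for `x ≥ t`, and `0` for `x < t`. -/
def translate (φ : ℝ → ℝ) (t : ℝ) (f : ℝ → ℂ) (x : ℝ) : ℂ :=
  if t ≤ x then (weight φ t x : ℂ) * f (x - t) else 0

lemma measurePreserving_sub (t : ℝ) :
    MeasurePreserving (fun x : ℝ => x - t) (volume.restrict (Ici t)) halfLine := by
  have h := (measurePreserving_sub_right (volume : Measure ℝ) t).restrict_preimage
    (measurableSet_Ici (a := (0 : ℝ)))
  have e : (fun x : ℝ => x - t) ⁻¹' Ici 0 = Ici t := by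
    ext x; simp
  rwa [e] at h

lemma ae_shift {t : ℝ} (ht : 0 ≤ t) {p : ℝ → Prop} (h : ∀ᵐ x ∂halfLine, p x) :
    ∀ᵐ x ∂halfLine, t ≤ x → p (x - t) := by
  have h1 := (measurePreserving_sub t).quasiMeasurePreserving.ae h
  have e : (volume.restrict (Ici t) : Measure ℝ) = halfLine.restrict (Ici t) := by
    rw [Measure.restrict_restrict measurableSet_Ici,
      inter_eq_left.2 (Ici_subset_Ici.2 ht)]
  rw [e, ae_restrict_iff' measurableSet_Ici] at h1
  exact h1

lemma translate_eq_indicator (φ : ℝ → ℝ) (t : ℝ) (f : ℝ → ℂ) :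
    translate φ t f =
      (Ici t).indicator fun x => (Real.sqrt (φ x / φ (x - t)) : ℂ) * f (x - t) := by
  ext x
  by_cases hx : t ≤ x <;> simp [translate, weight, hx]

lemma IsSymbol.aestronglyMeasurable_translate {φ : ℝ → ℝ} (hφ : IsSymbol φ) {t : ℝ}
    (ht : 0 ≤ t) {f : ℝ → ℂ} (hf : AEStronglyMeasurable f halfLine) :
    AEStronglyMeasurable (translate φ t f) halfLine := by
  rw [translate_eq_indicator, aestronglyMeasurable_indicator_iff measurableSet_Ici,
    Measure.restrict_restrict measurableSet_Ici, inter_eq_left.2 (Ici_subset_Ici.2 ht)]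
  refine AEStronglyMeasurable.mul (ContinuousOn.aestronglyMeasurable ?_ measurableSet_Ici)
    (hf.comp_measurePreserving (measurePreserving_sub t))
  refine Complex.continuous_ofReal.comp_continuousOn (ContinuousOn.sqrt (ContinuousOn.div ?_ ?_ ?_))
  · exact hφ.continuousOn.mono (Ici_subset_Ici.2 ht)
  · exact hφ.continuousOn.comp (by fun_prop) fun x hx => by simpa using hx
  · exact fun x hx => (hφ.pos _ (by simpa using hx)).ne'

lemma IsSymbol.exists_eLpNorm_translate_le {φ : ℝ → ℝ} (hφ : IsSymbol φ) {t : ℝ}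
    (ht : 0 ≤ t) : ∃ M : ℝ, 0 ≤ M ∧ ∀ f : ℝ → ℂ, AEStronglyMeasurable f halfLine →
      eLpNorm (translate φ t f) 2 halfLine ≤ ENNReal.ofReal M * eLpNorm f 2 halfLine := by
  obtain ⟨M, hM⟩ := hφ.essBounded t ht
  refine ⟨max M 0, le_max_right _ _, fun f hf => ?_⟩
  have e : (volume.restrict (Ici t) : Measure ℝ) = halfLine.restrict (Ici t) := by
    rw [Measure.restrict_restrict measurableSet_Ici,
      inter_eq_left.2 (Ici_subset_Ici.2 ht)]
  have h1 : eLpNorm ((Ici t).indicator fun x => f (x - t)) 2 halfLine = eLpNorm f 2 halfLine := by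
    rw [eLpNorm_indicator_eq_eLpNorm_restrict measurableSet_Ici, ← e]
    exact eLpNorm_comp_measurePreserving hf (measurePreserving_sub t)
  rw [← h1]
  have h2 : ∀ᵐ x ∂halfLine,
      ‖translate φ t f x‖ ≤ max M 0 * ‖(Ici t).indicator (fun x => f (x - t)) x‖ := by
    filter_upwards [hM] with x hx
    by_cases h : t ≤ x
    · have h0 : 0 ≤ weight φ t x := by simp [weight, h, Real.sqrt_nonneg]
      have h3 : translate φ t f x = (weight φ t x : ℂ) * f (x - t) := if_pos h
      rw [h3, norm_mul, Complex.norm_real, Real.norm_of_nonneg h0,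
        indicator_of_mem (show x ∈ Ici t from h)]
      exact mul_le_mul_of_nonneg_right (hx.trans (le_max_left _ _)) (norm_nonneg _)
    · have h3 : translate φ t f x = 0 := if_neg h
      rw [h3, norm_zero]
      positivity
  exact eLpNorm_le_mul_eLpNorm_of_ae_le_mul h2 2

lemma IsSymbol.memLp_translate {φ : ℝ → ℝ} (hφ : IsSymbol φ) {t : ℝ} (ht : 0 ≤ t) (f : L2) :
    MemLp (translate φ t f) 2 halfLine := by
  obtain ⟨M, -, h⟩ := hφ.exists_eLpNorm_translate_le ht
  refine ⟨hφ.aestronglyMeasurable_translate ht (Lp.aestronglyMeasurable f),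
    (h f (Lp.aestronglyMeasurable f)).trans_lt ?_⟩
  exact ENNReal.mul_lt_top ENNReal.ofReal_lt_top (Lp.memLp f).2

/-- The operator `S_t` of the weighted translation semigroup with symbol `φ`: the bounded
operator on `L²(ℝ₊)` given by `(S_t f)(x) = φ_t(x) f(x - t)` for `x ≥ t` and `0` for `x < t`. -/
def S {φ : ℝ → ℝ} (hφ : IsSymbol φ) {t : ℝ} (ht : 0 ≤ t) : L2 →L[ℂ] L2 :=
  LinearMap.mkContinuousOfExistsBound
    { toFun := fun f => (hφ.memLp_translate ht f).toLp (translate φ t f)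
      map_add' := fun f g => by
        rw [← MemLp.toLp_add, MemLp.toLp_eq_toLp_iff]
        filter_upwards [ae_shift ht (Lp.coeFn_add f g)] with x hx
        by_cases h : t ≤ x
        · simp only [translate, h, if_true, hx h, Pi.add_apply, mul_add]
        · simp [translate, h]
      map_smul' := fun c f => by
        rw [RingHom.id_apply, ← MemLp.toLp_const_smul, MemLp.toLp_eq_toLp_iff]
        filter_upwards [ae_shift ht (Lp.coeFn_smul c f)] with x hx
        by_cases h : t ≤ x
        · simp only [translate, h, if_true, hx h, Pi.smul_apply, smul_eq_mul, mul_left_comm]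
        · simp [translate, h] }
    (by
      obtain ⟨M, hM, h⟩ := hφ.exists_eLpNorm_translate_le ht
      refine ⟨M, fun f => ?_⟩
      have := ENNReal.toReal_mono
        (ENNReal.mul_lt_top ENNReal.ofReal_lt_top (Lp.memLp f).2).ne
        (h f (Lp.aestronglyMeasurable f))
      rw [ENNReal.toReal_mul, ENNReal.toReal_ofReal hM] at this
      rw [← Lp.norm_toLp _ (hφ.memLp_translate ht f), ← Lp.norm_def] at this
      exact this)

lemma coeFn_S {φ : ℝ → ℝ} (hφ : IsSymbol φ) {t : ℝ} (ht : 0 ≤ t) (f : L2) :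
    S hφ ht f =ᵐ[halfLine] translate φ t f :=
  (hφ.memLp_translate ht f).coeFn_toLp

/-- A bounded operator is left invertible if it has a bounded left inverse. -/
def LeftInvertible {H : Type*} [NormedAddCommGroup H] [InnerProductSpace ℂ H]
    (T : H →L[ℂ] H) : Prop :=
  ∃ A : H →L[ℂ] H, A ∘L T = ContinuousLinearMap.id ℂ H

/-- The Cauchy dual `T' = T (T* T)⁻¹` of an operator `T` (meaningful when `T` is left invertible,
since then `T* T` is invertible). -/
def cauchyDual {H : Type*} [NormedAddCommGroup H] [InnerProductSpace ℂ H] [CompleteSpace H]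
    (T : H →L[ℂ] H) : H →L[ℂ] H :=
  T * Ring.inverse (ContinuousLinearMap.adjoint T * T)

lemma LeftInvertible.isUnit {H : Type*} [NormedAddCommGroup H] [InnerProductSpace ℂ H]
    [CompleteSpace H] {T : H →L[ℂ] H} (hT : LeftInvertible T) :
    IsUnit (ContinuousLinearMap.adjoint T * T) := by
  obtain ⟨A, hA⟩ := hT
  set c : NNReal := ((‖A‖₊ + 1) ^ 2)⁻¹ with hc
  have hc0 : 0 < c := by positivity
  refine ContinuousLinearMap.isUnit_of_forall_le_norm_inner_map _ hc0 fun x => ?_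
  have h1 : ‖x‖ ≤ (‖A‖ + 1) * ‖T x‖ := by
    have : A (T x) = x := by simpa using congrArg (fun B : H →L[ℂ] H => B x) hA
    calc ‖x‖ = ‖A (T x)‖ := by rw [this]
      _ ≤ ‖A‖ * ‖T x‖ := A.le_opNorm _
      _ ≤ _ := by gcongr; linarith
  have h2 : ‖⟪(ContinuousLinearMap.adjoint T * T) x, x⟫_ℂ‖ = ‖T x‖ ^ 2 := by
    rw [mul_apply_eq_comp, ContinuousLinearMap.adjoint_inner_left,
      inner_self_eq_norm_sq_to_K]
    simp
  rw [h2, hc]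
  push_cast
  rw [mul_comm, inv_mul_le_iff₀ (by positivity)]
  calc ‖x‖ ^ 2 ≤ ((‖A‖ + 1) * ‖T x‖) ^ 2 := by gcongr
    _ = _ := by ring

/-- The operator `L_t`, the adjoint of the Cauchy dual of `S_t`. -/
def L {φ : ℝ → ℝ} (hφ : IsSymbol φ) {t : ℝ} (ht : 0 ≤ t) : L2 →L[ℂ] L2 :=
  ContinuousLinearMap.adjoint (cauchyDual (S hφ ht))

/-- The closed subspace `E = ker S_t*` of `L²(ℝ₊)`. -/
abbrev E {φ : ℝ → ℝ} (hφ : IsSymbol φ) {t : ℝ} (ht : 0 ≤ t) : Submodule ℂ L2 :=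
  LinearMap.ker (ContinuousLinearMap.adjoint (S hφ ht)).toLinearMap

/-- The open disc with centre `0` and radius `r(L_t)⁻¹`, where `r` is the spectral radius. -/
def disc {φ : ℝ → ℝ} (hφ : IsSymbol φ) {t : ℝ} (ht : 0 ≤ t) : Set ℂ :=
  {z | ‖z‖ₑ < (spectralRadius ℂ (L hφ ht))⁻¹}

/-- A function on a set `D ⊆ ℂ` with values in `V` is analytic. -/
def IsAnalytic {V : Type*} [NormedAddCommGroup V] [NormedSpace ℂ V] {D : Set ℂ}
    (g : D → V) : Prop :=
  ∃ G : ℂ → V, AnalyticOnNhd ℂ G D ∧ ∀ z : D, g z = G z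

/-- A function on a set `D ⊆ ℂ` is a polynomial with coefficients in `V`. -/
def IsPoly {V : Type*} [NormedAddCommGroup V] [NormedSpace ℂ V] {D : Set ℂ}
    (g : D → V) : Prop :=
  ∃ p : PolynomialModule ℂ V, ∀ z : D, g z = PolynomialModule.eval (z : ℂ) p

/-- The basic Haar function. -/
def haarMother (x : ℝ) : ℝ :=
  if 0 ≤ x ∧ x < 1 / 2 then 1 else if 1 / 2 ≤ x ∧ x < 1 then -1 else 0

/-- The Haar function `ψ_{jk}(x) = 2^{j/2} ψ(2^j x - k)`. -/
def haar (j : ℤ) (k : ℕ) (x : ℝ) : ℝ :=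
  (2 : ℝ) ^ ((j : ℝ) / 2) * haarMother ((2 : ℝ) ^ j * x - k)

end WTS

end

namespace WTS

open Filter Topology

/-! The bound on quotients makes `φ⁻¹` a symbol, and the Cauchy dual of `S_t` is the translation
with symbol `φ⁻¹` (`cauchyDual_S`). Hence `(L_t^n f)(x) = √(φ x / φ (x + n t)) f (x + n t)`, while
`E` consists of the functions vanishing on `[t, ∞)`. The model sends `f` to `∑ zⁿ P_E L_tⁿ f`, which
converges on the disc. Its `n`-th coefficient is the block of `f` on `[n t, (n + 1) t)`, moved to
`[0, t)` with a positive weight (`coeff_eq_zero_iff`), so `f` is determined by its function. One may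
therefore take `L²` itself as the model space, with `U` the identity, `S_t` as multiplication by
`z`, and `evalAt` as evaluation.

The kernel is `evalAt z` composed with the adjoint of `evalAt w`. Distinct blocks do not interact,
and on each block the weight is squared, so it is a multiplication operator
(`coeFn_evalAt_adjoint_evalAt`).

A function of bounded support meets finitely many blocks, so its image is a polynomial. The Haar
functions have bounded support; their completeness (`haarBasis`) gives both the polynomial
orthonormal basis and the density of polynomials. -/

/-! ### Translations of the half line and the adjoint of `S`. -/

lemma measurePreserving_add (s : ℝ) :
    MeasurePreserving (fun x : ℝ => x + s) halfLine (volume.restrict (Ici s)) := by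
  have h := (measurePreserving_add_right (volume : Measure ℝ) s).restrict_preimage
    (measurableSet_Ici (a := s))
  have e : (fun x : ℝ => x + s) ⁻¹' Ici s = Ici 0 := by
    ext x; simp
  rwa [e] at h

lemma ae_add {s : ℝ} (hs : 0 ≤ s) {p : ℝ → Prop} (h : ∀ᵐ x ∂halfLine, p x) :
    ∀ᵐ x ∂halfLine, p (x + s) := by
  refine (measurePreserving_add s).quasiMeasurePreserving.ae ?_
  exact ae_mono (Measure.restrict_mono (Ici_subset_Ici.2 hs) le_rfl) h

lemma ae_nonneg : ∀ᵐ x ∂halfLine, 0 ≤ x := ae_restrict_mem measurableSet_Ici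

lemma ae_of_ae_add {s : ℝ} (hs : 0 ≤ s) {p : ℝ → Prop} (h : ∀ᵐ x ∂halfLine, p (x + s)) :
    ∀ᵐ x ∂halfLine, s ≤ x → p x := by
  filter_upwards [ae_shift hs h] with x hx hsx
  simpa using hx hsx

lemma restrict_Ici_eq {s : ℝ} (hs : 0 ≤ s) :
    (volume.restrict (Ici s) : Measure ℝ) = halfLine.restrict (Ici s) := by
  rw [Measure.restrict_restrict measurableSet_Ici, inter_eq_left.2 (Ici_subset_Ici.2 hs)]

lemma IsSymbol.memLp_backward {φ : ℝ → ℝ} (hφ : IsSymbol φ) {s : ℝ} (hs : 0 ≤ s) (f : L2) :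
    MemLp (fun x => (√(φ (x + s) / φ x) : ℂ) * f (x + s)) 2 halfLine := by
  have h2 : MemLp (fun x => f (x + s)) 2 halfLine :=
    ((Lp.memLp f).mono_measure
      (Measure.restrict_mono (Ici_subset_Ici.2 hs) le_rfl)).comp_measurePreserving
        (measurePreserving_add s)
  obtain ⟨M, hM⟩ := hφ.essBounded s hs
  refine h2.of_le_mul (c := M) ?_ ?_
  · refine AEStronglyMeasurable.mul (ContinuousOn.aestronglyMeasurable ?_ measurableSet_Ici) h2.1
    refine Complex.continuous_ofReal.comp_continuousOn
      (ContinuousOn.sqrt (ContinuousOn.div ?_ hφ.continuousOn fun x hx => (hφ.pos x hx).ne'))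
    exact hφ.continuousOn.comp (by fun_prop) fun x (hx : 0 ≤ x) => add_nonneg hx hs
  · filter_upwards [ae_add hs hM, ae_nonneg] with x hx hx0
    have h3 : weight φ s (x + s) = √(φ (x + s) / φ x) := by simp [weight, hx0]
    rw [norm_mul, Complex.norm_real, Real.norm_of_nonneg (Real.sqrt_nonneg _), ← h3]
    gcongr

lemma coeFn_adjoint_S {φ : ℝ → ℝ} (hφ : IsSymbol φ) {s : ℝ} (hs : 0 ≤ s) (f : L2) :
    ∀ᵐ x ∂halfLine, ContinuousLinearMap.adjoint (S hφ hs) f x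
      = (√(φ (x + s) / φ x) : ℂ) * f (x + s) := by
  suffices h : ContinuousLinearMap.adjoint (S hφ hs) f = (hφ.memLp_backward hs f).toLp _ by
    rw [h]
    exact (hφ.memLp_backward hs f).coeFn_toLp
  refine ext_inner_left ℂ fun h => ?_
  rw [ContinuousLinearMap.adjoint_inner_right, L2.inner_def, L2.inner_def]
  set G : ℝ → ℂ := fun y => ⟪h y, (√(φ (y + s) / φ y) : ℂ) * f (y + s)⟫_ℂ with hG
  have e1 : ∫ x, ⟪S hφ hs h x, f x⟫_ℂ ∂halfLine = ∫ x in Ici s, G (x - s) := by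
    rw [restrict_Ici_eq hs, ← integral_indicator (μ := halfLine)
      (f := fun x => G (x - s)) measurableSet_Ici]
    refine integral_congr_ae ?_
    filter_upwards [coeFn_S hφ hs h] with x hx
    rw [hx]
    by_cases hsx : s ≤ x
    · rw [indicator_of_mem (show x ∈ Ici s from hsx)]
      simp [hG, translate, weight, hsx]
      ring
    · rw [indicator_of_notMem (show x ∉ Ici s from hsx)]
      simp [translate, hsx]
  rw [e1]
  -- Change of variables `y = x - s`, from `[s, ∞)` onto the half line.
  refine ((measurePreserving_sub s).integral_comp
    (MeasurableEquiv.subRight s).measurableEmbedding G).trans ?_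
  refine integral_congr_ae ?_
  filter_upwards [(hφ.memLp_backward hs f).coeFn_toLp] with x hx
  rw [hx]

/-! ### The reciprocal symbol and the Cauchy dual. -/

/-- The reciprocal of a symbol whose quotients are bounded below is a symbol. -/
lemma IsSymbol.inv {φ : ℝ → ℝ} (hφ : IsSymbol φ)
    (hinf : ∀ s : ℝ, 0 ≤ s → 0 < ⨅ x : Ici (0 : ℝ), φ (x + s) / φ x) : IsSymbol φ⁻¹ where
  continuousOn := hφ.continuousOn.inv₀ fun x hx => (hφ.pos x hx).ne'
  pos x hx := inv_pos.2 (hφ.pos x hx)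
  essBounded s hs := by
    refine ⟨√(⨅ x : Ici (0 : ℝ), φ (x + s) / φ x)⁻¹, ?_⟩
    filter_upwards with x
    by_cases hx : s ≤ x
    · have h0 : 0 ≤ x - s := sub_nonneg.2 hx
      have hb : BddBelow (range fun x : Ici (0 : ℝ) => φ (x + s) / φ x) :=
        ⟨0, by
          rintro _ ⟨y, rfl⟩
          exact (div_pos (hφ.pos _ (add_nonneg y.2 hs)) (hφ.pos _ y.2)).le⟩
      have h1 := ciInf_le hb ⟨x - s, h0⟩
      simp only [sub_add_cancel] at h1
      rw [weight, if_pos hx]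
      refine Real.sqrt_le_sqrt ?_
      calc φ⁻¹ x / φ⁻¹ (x - s) = (φ x / φ (x - s))⁻¹ := by
            simp [div_eq_mul_inv, mul_comm]
        _ ≤ _ := inv_anti₀ (hinf s hs) h1
    · rw [weight, if_neg hx]
      exact Real.sqrt_nonneg _

section

variable {φ : ℝ → ℝ} (hφ : IsSymbol φ) (hφ' : IsSymbol φ⁻¹) {t : ℝ} (ht : 0 ≤ t)

lemma coeFn_adjoint_S_inv {s : ℝ} (hs : 0 ≤ s) (f : L2) :
    ∀ᵐ x ∂halfLine, ContinuousLinearMap.adjoint (S hφ' hs) f x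
      = (√(φ x / φ (x + s)) : ℂ) * f (x + s) := by
  filter_upwards [coeFn_adjoint_S hφ' hs f] with x hx
  rw [hx]
  simp [div_eq_mul_inv, mul_comm]

include hφ in
-- The weights `√(φ x / φ (x + t))` and `√(φ (x + t) / φ x)` cancel.
lemma adjoint_S_inv_comp_S :
    ContinuousLinearMap.adjoint (S hφ' ht) ∘L S hφ ht = ContinuousLinearMap.id ℂ L2 := by
  ext1 f
  refine Lp.ext ?_
  filter_upwards [coeFn_adjoint_S_inv hφ' ht (S hφ ht f), ae_add ht (coeFn_S hφ ht f),
    ae_nonneg] with x h1 h2 h0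
  rw [ContinuousLinearMap.comp_apply, h1, h2, translate, if_pos (by linarith), weight,
    if_pos (by linarith)]
  simp only [add_sub_cancel_right, ContinuousLinearMap.id_apply]
  have p1 := hφ.pos x h0
  have p2 := hφ.pos (x + t) (by linarith)
  rw [← mul_assoc, ← Complex.ofReal_mul, ← Real.sqrt_mul (by positivity)]
  rw [div_mul_div_comm, mul_comm, mul_comm (φ (x + t)), div_self (by positivity)]
  simp

include hφ' in
lemma leftInvertible_S : LeftInvertible (S hφ ht) := ⟨_, adjoint_S_inv_comp_S hφ hφ' ht⟩

/-- The Cauchy dual of a weighted translation is the translation with the reciprocal symbol. -/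
lemma cauchyDual_S : cauchyDual (S hφ ht) = S hφ' ht := by
  have hu := (leftInvertible_S hφ hφ' ht).isUnit
  -- The invertible factor `S* S` can be cancelled on the right, so no formula for its inverse is
  -- needed.
  suffices h : S hφ ht = S hφ' ht * (ContinuousLinearMap.adjoint (S hφ ht) * S hφ ht) by
    rw [cauchyDual]
    nth_rw 1 [h]
    rw [mul_assoc, Ring.mul_inverse_cancel _ hu, mul_one]
  ext1 f
  refine Lp.ext ?_
  filter_upwards [coeFn_S hφ ht f, 
    coeFn_S hφ' ht (ContinuousLinearMap.adjoint (S hφ ht) (S hφ ht f)),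
    ae_shift ht (coeFn_adjoint_S hφ ht (S hφ ht f)), ae_nonneg] with x h1 h2 h3 h0
  rw [mul_apply_eq_comp, mul_apply_eq_comp, h1, h2]
  by_cases hx : t ≤ x
  · have p1 := hφ.pos x h0
    have p2 := hφ.pos (x - t) (by linarith)
    rw [translate, translate, if_pos hx, if_pos hx, h3 hx, weight, weight, if_pos hx, if_pos hx]
    simp only [sub_add_cancel]
    rw [h1, translate, if_pos hx, weight, if_pos hx]
    simp only [← mul_assoc, ← Complex.ofReal_mul]
    rw [← Real.sqrt_mul (by simp; positivity)]
    have : φ⁻¹ x / φ⁻¹ (x - t) * (φ x / φ (x - t)) = 1 := by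
      simp
      field_simp
    rw [this]
    simp
  · simp [translate, hx]

include hφ in
lemma L_eq : L hφ ht = ContinuousLinearMap.adjoint (S hφ' ht) := by
  rw [L, cauchyDual_S hφ hφ' ht]

include hφ' in
lemma L_comp_S (f : L2) : L hφ ht (S hφ ht f) = f := by
  rw [L_eq hφ hφ' ht]
  exact congrArg (fun A : L2 →L[ℂ] L2 => A f) (adjoint_S_inv_comp_S hφ hφ' ht)

include hφ' in
-- The product of the successive quotients `φ (x + i t) / φ (x + (i + 1) t)` telescopes.
lemma coeFn_L_pow (n : ℕ) (f : L2) :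
    ∀ᵐ x ∂halfLine, (L hφ ht ^ n) f x = (√(φ x / φ (x + n * t)) : ℂ) * f (x + n * t) := by
  induction n generalizing f with
  | zero =>
    filter_upwards [ae_nonneg] with x h0
    simp [(hφ.pos x h0).ne']
  | succ n ih =>
    rw [pow_succ, mul_apply_eq_comp]
    have hnt : 0 ≤ n * t := by positivity
    have h2 := coeFn_adjoint_S_inv hφ' ht f
    rw [← L_eq hφ hφ' ht] at h2
    filter_upwards [ih (L hφ ht f), ae_add hnt h2, ae_nonneg] with x h1 h2 h0
    rw [h1, h2]
    have p1 := hφ.pos x h0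
    have p2 := hφ.pos (x + n * t) (by positivity)
    have e : x + n * t + t = x + (n + 1 : ℕ) * t := by push_cast; ring
    have p3 := hφ.pos (x + (n + 1 : ℕ) * t) (by positivity)
    rw [e, ← mul_assoc, ← Complex.ofReal_mul, ← Real.sqrt_mul (by positivity),
      div_mul_div_cancel₀ p2.ne']

lemma L_pow_eq (n : ℕ) :
    L hφ ht ^ n = ContinuousLinearMap.adjoint (S hφ' (mul_nonneg n.cast_nonneg ht)) := by
  ext1 f
  refine Lp.ext ?_
  filter_upwards [coeFn_L_pow hφ hφ' ht n f,
    coeFn_adjoint_S_inv hφ' (mul_nonneg n.cast_nonneg ht) f] with x h1 h2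
  rw [h1, h2]

lemma mem_E_iff (f : L2) : f ∈ E hφ ht ↔ ∀ᵐ x ∂halfLine, t ≤ x → f x = 0 := by
  rw [LinearMap.mem_ker, ContinuousLinearMap.coe_coe, Lp.eq_zero_iff_ae_eq_zero]
  constructor
  · intro h
    refine ae_of_ae_add ht ?_
    filter_upwards [h, coeFn_adjoint_S hφ ht f, ae_nonneg] with x h1 h2 h0
    rw [h2] at h1
    have p1 := hφ.pos x h0
    have p2 := hφ.pos (x + t) (by linarith)
    have p3 : 0 < √(φ (x + t) / φ x) := by positivity
    simpa [p3.ne'] using h1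
  · intro h
    filter_upwards [coeFn_adjoint_S hφ ht f, ae_add ht h, ae_nonneg] with x h1 h2 h0
    rw [h1, h2 (by linarith)]
    simp

end

/-! ### Taylor coefficients and the analytic model. -/

/-- Inside the disc of radius `r(a)⁻¹` the geometric series of `a` converges absolutely. -/
lemma summable_norm_pow_mul_pow {A : Type*} [NormedRing A] [NormedAlgebra ℂ A] [CompleteSpace A]
    (a : A) {r : NNReal} (hr : (r : ℝ≥0∞) < (spectralRadius ℂ a)⁻¹) :
    Summable fun n : ℕ => ‖a ^ n‖ * (r : ℝ) ^ n := by
  obtain ⟨r', h1, h2⟩ := ENNReal.lt_iff_exists_nnreal_btwn.1 hr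
  have h0 : 0 < r' := lt_of_le_of_lt bot_le (ENNReal.coe_lt_coe.1 h1)
  -- The map `z ↦ (1 - z a)⁻¹` is holomorphic on the disc of radius `r'`, and by uniqueness its
  -- Cauchy power series is the geometric series.
  have H₁ := (spectrum.differentiableOn_inverse_one_sub_smul h2).hasFPowerSeriesOnBall h0
  have H₂ := ((spectrum.hasFPowerSeriesOnBall_inverse_one_sub_smul ℂ a).exchange_radius H₁).r_le
  simpa using FormalMultilinearSeries.summable_norm_mul_pow _ (h1.trans_le H₂)

lemma summable_pow_smul {V W : Type*} [NormedAddCommGroup V] [NormedSpace ℂ V]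
    [NormedAddCommGroup W] [NormedSpace ℂ W] [CompleteSpace W] {A : ℕ → V →L[ℂ] W} {z : ℂ}
    (h : Summable fun n => ‖A n‖ * ‖z‖ ^ n) : Summable fun n => z ^ n • A n := by
  refine Summable.of_norm (h.congr fun n => ?_)
  rw [norm_smul, norm_pow, mul_comm]

section

variable {φ : ℝ → ℝ} (hφ : IsSymbol φ) (hφ' : IsSymbol φ⁻¹) {t : ℝ} (ht : 0 ≤ t)

/-- The `n`-th Taylor coefficient `P_E L_t^n` of the model map. -/
noncomputable def coeff (n : ℕ) : L2 →L[ℂ] E hφ ht :=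
  (E hφ ht).orthogonalProjectionOnto ∘L L hφ ht ^ n

lemma norm_coeff_le (n : ℕ) : ‖coeff hφ ht n‖ ≤ ‖L hφ ht ^ n‖ := by
  refine (ContinuousLinearMap.opNorm_comp_le _ _).trans ?_
  exact mul_le_of_le_one_left (norm_nonneg _) (Submodule.orthogonalProjectionOnto_norm_le _)

/-- The truncation of `f` to `[0, t)` lies in `E`, and the remainder is orthogonal to `E`. -/
lemma coeFn_orthogonalProjection_E (f : L2) :
    ∀ᵐ x ∂halfLine, ((E hφ ht).orthogonalProjectionOnto f : L2) x = if x < t then f x else 0 := by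
  have hm : MemLp (fun x => if x < t then f x else 0) 2 halfLine := by
    have := (Lp.memLp f).indicator (measurableSet_Iio (a := t))
    refine this.congr_norm ?_ ?_
    · have e : (fun x => if x < t then f x else 0) = (Iio t).indicator f := by
        ext x; simp [indicator]
      rw [e]; exact this.1
    · filter_upwards with x
      simp [indicator]
  suffices h : ((E hφ ht).orthogonalProjectionOnto f : L2) = hm.toLp _ by
    rw [h]; exact hm.coeFn_toLp
  rw [Submodule.coe_orthogonalProjectionOnto_apply]
  refine (Submodule.eq_starProjection_of_mem_of_inner_eq_zero ?_ fun w hw => ?_)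
  · rw [mem_E_iff]
    filter_upwards [hm.coeFn_toLp] with x hx hxt
    rw [hx, if_neg (not_lt.2 hxt)]
  · rw [mem_E_iff] at hw
    rw [L2.inner_def]
    refine (integral_congr_ae ?_).trans (integral_zero _ _)
    filter_upwards [Lp.coeFn_sub f (hm.toLp _), hm.coeFn_toLp, hw] with x h1 h2 h3
    rw [h1, Pi.sub_apply, h2]
    by_cases hx : x < t
    · simp [hx]
    · simp [h3 (not_lt.1 hx)]

include hφ' in
lemma coeFn_coeff (n : ℕ) (f : L2) :
    ∀ᵐ x ∂halfLine, (coeff hφ ht n f : L2) x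
      = if x < t then (√(φ x / φ (x + n * t)) : ℂ) * f (x + n * t) else 0 := by
  filter_upwards [coeFn_orthogonalProjection_E hφ ht ((L hφ ht ^ n) f),
    coeFn_L_pow hφ hφ' ht n f] with x h1 h2
  rw [coeff, ContinuousLinearMap.comp_apply, h1, h2]

include hφ' in
-- The weight is strictly positive, so the coefficient loses nothing of the `n`-th block.
lemma coeff_eq_zero_iff (n : ℕ) (f : L2) :
    coeff hφ ht n f = 0 ↔ ∀ᵐ x ∂halfLine, n * t ≤ x → x < (n + 1) * t → f x = 0 := by
  have hnt : 0 ≤ n * t := by positivity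
  rw [← Submodule.coe_eq_zero, Lp.eq_zero_iff_ae_eq_zero]
  constructor
  · intro h
    refine ae_of_ae_add hnt ?_
    filter_upwards [h, coeFn_coeff hφ hφ' ht n f, ae_nonneg] with x h1 h2 h0 hx
    rw [h2, if_pos (by linarith)] at h1
    have p1 := hφ.pos x h0
    have p2 := hφ.pos (x + n * t) (by positivity)
    have p3 : 0 < √(φ x / φ (x + n * t)) := by positivity
    simpa [p3.ne'] using h1
  · intro h
    filter_upwards [coeFn_coeff hφ hφ' ht n f, ae_add hnt h, ae_nonneg] with x h1 h2 h0
    rw [h1]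
    split_ifs with hx
    · rw [h2 (by linarith) (by linarith)]; simp
    · rfl

include hφ' in
lemma eq_zero_of_coeff_eq_zero {t : ℝ} (ht : 0 < t) {f : L2}
    (h : ∀ n, coeff hφ ht.le n f = 0) : f = 0 := by
  rw [Lp.eq_zero_iff_ae_eq_zero]
  filter_upwards [ae_all_iff.2 fun n => (coeff_eq_zero_iff hφ hφ' ht.le n f).1 (h n), ae_nonneg]
    with x hx h0
  -- The blocks cover the half line; this is the one containing `x`.
  refine hx ⌊x / t⌋₊ ?_ ?_
  · exact (le_div_iff₀ ht).1 (Nat.floor_le (by positivity))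
  · exact (div_lt_iff₀ ht).1 (Nat.lt_floor_add_one _)

include hφ' in
-- Translation by `m t` carries `E` into the `m`-th block. The symbol `ψ` is free because both `φ`
-- (monomials) and `φ⁻¹` (kernel) are needed.
lemma coeff_S_of_ne {ψ : ℝ → ℝ} (hψ : IsSymbol ψ) {m n : ℕ} (hmn : n ≠ m) (e : E hφ ht) :
    coeff hφ ht n (S hψ (mul_nonneg m.cast_nonneg ht) e) = 0 := by
  have hmt : 0 ≤ m * t := by positivity
  rw [coeff_eq_zero_iff hφ hφ']
  filter_upwards [coeFn_S hψ hmt e, ae_shift hmt ((mem_E_iff hφ ht e).1 e.2)] with x h1 h2 h3 h4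
  rw [h1, translate]
  split_ifs with hx
  · rw [h2 hx, mul_zero]
    rcases lt_or_gt_of_ne hmn with h | h
    · have : ((n : ℝ) + 1) * t ≤ m * t := by
        gcongr; exact_mod_cast h
      linarith
    · have : ((m : ℝ) + 1) * t ≤ n * t := by
        gcongr; exact_mod_cast h
      linarith
  · rfl

include hφ' in
lemma coeff_S_self (n : ℕ) (e : E hφ ht) :
    coeff hφ ht n (S hφ (mul_nonneg n.cast_nonneg ht) e) = e := by
  have hnt : 0 ≤ n * t := by positivity
  rw [coeff, L_pow_eq hφ hφ' ht, ContinuousLinearMap.comp_apply]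
  have := congrArg (fun A : L2 →L[ℂ] L2 => A e) (adjoint_S_inv_comp_S hφ hφ' hnt)
  simp only [ContinuousLinearMap.comp_apply, ContinuousLinearMap.id_apply] at this
  rw [this, Submodule.orthogonalProjectionOnto_mem_subspace_eq_self]

lemma coeff_zero_mem (e : E hφ ht) : coeff hφ ht 0 e = e := by
  simp [coeff]

include hφ' in
lemma coeff_zero_S (f : L2) : coeff hφ ht 0 (S hφ ht f) = 0 := by
  rw [coeff_eq_zero_iff hφ hφ']
  filter_upwards [coeFn_S hφ ht f] with x h1 h2 h3
  rw [h1, translate, if_neg]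
  simpa using h3

include hφ' in
lemma coeff_succ_S (n : ℕ) (f : L2) : coeff hφ ht (n + 1) (S hφ ht f) = coeff hφ ht n f := by
  rw [coeff, ContinuousLinearMap.comp_apply, pow_succ, mul_apply_eq_comp, L_comp_S hφ hφ' ht, coeff,
    ContinuousLinearMap.comp_apply]

include hφ' in
lemma coeff_succ_mem (n : ℕ) (e : E hφ ht) : coeff hφ ht (n + 1) e = 0 := by
  rw [coeff_eq_zero_iff hφ hφ']
  filter_upwards [(mem_E_iff hφ ht e).1 e.2] with x h1 h2 _
  refine h1 (le_trans ?_ h2)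
  push_cast
  nlinarith [mul_nonneg n.cast_nonneg ht]

lemma summable_norm_coeff {r : NNReal} (hr : (r : ℝ≥0∞) < (spectralRadius ℂ (L hφ ht))⁻¹) :
    Summable fun n : ℕ => ‖coeff hφ ht n‖ * (r : ℝ) ^ n :=
  (summable_norm_pow_mul_pow _ hr).of_nonneg_of_le (fun _ => by positivity) fun n => by
    gcongr; exact norm_coeff_le hφ ht n

lemma summable_coeff (z : disc hφ ht) : Summable fun n : ℕ => (z : ℂ) ^ n • coeff hφ ht n := by
  have hz : ‖(z : ℂ)‖ₑ < (spectralRadius ℂ (L hφ ht))⁻¹ := z.2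
  exact summable_pow_smul (summable_norm_coeff hφ ht (r := ‖(z : ℂ)‖₊) hz)

/-- Evaluation at a point of the disc of the function with Taylor coefficients `coeff n f`. -/
noncomputable def evalAt (z : disc hφ ht) : L2 →L[ℂ] E hφ ht :=
  ∑' n : ℕ, (z : ℂ) ^ n • coeff hφ ht n

lemma hasSum_evalAt (z : disc hφ ht) (f : L2) :
    HasSum (fun n : ℕ => (z : ℂ) ^ n • coeff hφ ht n f) (evalAt hφ ht z f) :=
  (summable_coeff hφ ht z).hasSum.mapL (ContinuousLinearMap.apply ℂ (E hφ ht) f)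

/-- The power series with coefficients `coeff n f`. -/
noncomputable def coeffSeries (f : L2) : FormalMultilinearSeries ℂ ℂ (E hφ ht) := fun n =>
  ContinuousMultilinearMap.mkPiRing ℂ (Fin n) (coeff hφ ht n f)

lemma le_radius_coeffSeries (f : L2) :
    (spectralRadius ℂ (L hφ ht))⁻¹ ≤ (coeffSeries hφ ht f).radius := by
  refine ENNReal.le_of_forall_nnreal_lt fun r hr => ?_
  refine FormalMultilinearSeries.le_radius_of_summable_norm _ ?_
  refine ((summable_norm_coeff hφ ht hr).mul_left ‖f‖).of_nonneg_of_le
    (fun _ => by positivity) fun n => ?_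
  rw [coeffSeries, ContinuousMultilinearMap.norm_mkPiRing, ← mul_assoc, mul_comm ‖f‖]
  gcongr
  exact (coeff hφ ht n).le_opNorm f

lemma hasFPowerSeriesOnBall_coeffSeries (f : L2) :
    HasFPowerSeriesOnBall (coeffSeries hφ ht f).sum (coeffSeries hφ ht f) 0
      (spectralRadius ℂ (L hφ ht))⁻¹ := by
  -- The spectral radius is finite: exponent `0` in the power bound already dominates it by norms.
  have h0 : 0 < (spectralRadius ℂ (L hφ ht))⁻¹ :=
    ENNReal.inv_pos.2 ((spectrum.spectralRadius_le_pow_nnnorm_pow_one_div ℂ (L hφ ht) 0).trans_lt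
      (by simp [ENNReal.mul_lt_top_iff])).ne
  have h1 := le_radius_coeffSeries hφ ht f
  exact ((coeffSeries hφ ht f).hasFPowerSeriesOnBall (h0.trans_le h1)).mono h0 h1

lemma evalAt_eq_sum (z : disc hφ ht) (f : L2) :
    evalAt hφ ht z f = (coeffSeries hφ ht f).sum z := by
  rw [FormalMultilinearSeries.sum, ← (hasSum_evalAt hφ ht z f).tsum_eq]
  simp [coeffSeries]

lemma isAnalytic_evalAt (f : L2) : IsAnalytic fun z : disc hφ ht => evalAt hφ ht z f := by
  refine ⟨(coeffSeries hφ ht f).sum, ?_, fun z => evalAt_eq_sum hφ ht z f⟩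
  have h := (hasFPowerSeriesOnBall_coeffSeries hφ ht f).analyticOnNhd
  refine h.mono fun z (hz : ‖z‖ₑ < _) => ?_
  simpa [edist_zero_right] using hz

include hφ' in
-- By uniqueness of power series all coefficients vanish, hence every block of `f`.
lemma eq_zero_of_evalAt_eq_zero {t : ℝ} (ht : 0 < t) {f : L2}
    (h : ∀ z, evalAt hφ ht.le z f = 0) : f = 0 := by
  have h1 := hasFPowerSeriesOnBall_coeffSeries hφ ht.le f
  have h2 : (coeffSeries hφ ht.le f) = 0 := by
    refine (h1.congr (g := 0) fun z hz => ?_).hasFPowerSeriesAt.eq_zero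
    have hz' : z ∈ disc hφ ht.le := by
      simpa [edist_zero_right, disc] using hz
    rw [← evalAt_eq_sum hφ ht.le ⟨z, hz'⟩, h]
    rfl
  refine eq_zero_of_coeff_eq_zero hφ hφ' ht fun n => ?_
  have h3 := congrFun h2 n
  have h4 := congrArg (fun m => m fun _ => (1 : ℂ)) h3
  simpa [coeffSeries] using h4

lemma evalAt_eq_of_forall_ne (z : disc hφ ht) {f : L2} {n : ℕ}
    (h : ∀ m, m ≠ n → coeff hφ ht m f = 0) :
    evalAt hφ ht z f = (z : ℂ) ^ n • coeff hφ ht n f := by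
  rw [← (hasSum_evalAt hφ ht z f).tsum_eq]
  exact tsum_eq_single n fun m hm => by rw [h m hm, smul_zero]

include hφ' in
lemma evalAt_mem (z : disc hφ ht) (e : E hφ ht) : evalAt hφ ht z e = e := by
  rw [evalAt_eq_of_forall_ne hφ ht z (n := 0), pow_zero, one_smul, coeff_zero_mem]
  rintro (_ | m) hm
  · exact absurd rfl hm
  · exact coeff_succ_mem hφ hφ' ht m e

include hφ' in
lemma evalAt_S (z : disc hφ ht) (f : L2) :
    evalAt hφ ht z (S hφ ht f) = (z : ℂ) • evalAt hφ ht z f := by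
  rw [← (hasSum_evalAt hφ ht z _).tsum_eq, (hasSum_evalAt hφ ht z _).summable.tsum_eq_zero_add,
    coeff_zero_S hφ hφ' ht, smul_zero, zero_add, ← (hasSum_evalAt hφ ht z f).tsum_eq,
    ← (hasSum_evalAt hφ ht z f).summable.tsum_const_smul]
  congr 1 with n
  rw [coeff_succ_S hφ hφ' ht, pow_succ', mul_smul]

/-- Evaluation at `z` of a function with finitely many nonzero Taylor coefficients. -/
lemma isPoly_evalAt {f : L2} {N : ℕ} (h : ∀ n, N ≤ n → coeff hφ ht n f = 0) :
    IsPoly fun z : disc hφ ht => evalAt hφ ht z f := by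
  refine ⟨∑ n ∈ Finset.range N, PolynomialModule.single ℂ n (coeff hφ ht n f), fun z => ?_⟩
  change evalAt hφ ht z f = _
  rw [map_sum, ← (hasSum_evalAt hφ ht z f).tsum_eq, tsum_eq_sum (s := Finset.range N)]
  · simp only [PolynomialModule.eval_single]
  · intro n hn
    rw [h n (by simpa using hn), smul_zero]

include hφ' in
lemma exists_evalAt_eq_eval (p : PolynomialModule ℂ (E hφ ht)) :
    ∃ f : L2, ∀ z : disc hφ ht, evalAt hφ ht z f = PolynomialModule.eval (z : ℂ) p := by
  induction p using PolynomialModule.induction_linear with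
  | zero => exact ⟨0, fun z => by simp⟩
  | add p q hp hq =>
    obtain ⟨f, hf⟩ := hp
    obtain ⟨g, hg⟩ := hq
    exact ⟨f + g, fun z => by rw [map_add, map_add, hf, hg]⟩
  | single n e =>
    -- The monomial `zⁿ e` comes from `e` translated by `n t`, whose only nonzero coefficient can be
    -- the `n`-th.
    refine ⟨S hφ (mul_nonneg n.cast_nonneg ht) e, fun z => ?_⟩
    rw [PolynomialModule.eval_single, evalAt_eq_of_forall_ne hφ ht z
      (fun m hm => coeff_S_of_ne hφ hφ' ht hφ hm e), coeff_S_self hφ hφ' ht]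

end

/-! ### The kernel as a multiplication operator. -/

/-- A series that converges in `L²`, and pointwise almost everywhere, has its pointwise sum as
its sum in `L²`. -/
lemma ae_eq_tsum_of_hasSum {F : ℕ → L2} {g : L2} (hF : HasSum F g) {f : ℕ → ℝ → ℂ}
    (hf : ∀ n, ∀ᵐ x ∂halfLine, F n x = f n x)
    (hs : ∀ᵐ x ∂halfLine, Summable fun n => f n x) :
    ∀ᵐ x ∂halfLine, g x = ∑' n, f n x := by
  -- Convergence in `L²` gives convergence in measure, hence an almost everywhere convergent
  -- subsequence of partial sums.
  obtain ⟨ns, hns, hlim⟩ := (tendstoInMeasure_of_tendsto_Lp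
    hF.tendsto_sum_nat).exists_seq_tendsto_ae
  have hsum : ∀ N, ∀ᵐ x ∂halfLine, (∑ n ∈ Finset.range N, F n : L2) x
      = ∑ n ∈ Finset.range N, f n x := by
    intro N
    induction N with
    | zero =>
      filter_upwards [Lp.coeFn_zero ℂ 2 halfLine] with x hx
      rw [Finset.sum_range_zero, Finset.sum_range_zero]
      exact hx
    | succ N ih =>
      rw [Finset.sum_range_succ]
      filter_upwards [ih, hf N, Lp.coeFn_add (∑ n ∈ Finset.range N, F n) (F N)] with x h1 h2 h3
      rw [h3, Pi.add_apply, h1, h2, Finset.sum_range_succ]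
  filter_upwards [hlim, ae_all_iff.2 hsum, hs] with x h1 h2 h3
  refine tendsto_nhds_unique h1 ?_
  simp only [h2]
  exact h3.hasSum.tendsto_sum_nat.comp hns.tendsto_atTop

lemma inner_smul_eq_inner_conj_smul {V : Type*} [NormedAddCommGroup V] [InnerProductSpace ℂ V]
    {c : ℂ} {x x' y y' : V} (h : ⟪x, y⟫_ℂ = ⟪x', y'⟫_ℂ) : ⟪x, c • y⟫_ℂ = ⟪conj c • x', y'⟫_ℂ := by
  rw [inner_smul_right, inner_smul_left, Complex.conj_conj, h]

section

variable {φ : ℝ → ℝ} (hφ : IsSymbol φ) (hφ' : IsSymbol φ⁻¹) {t : ℝ} (ht : 0 ≤ t)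

include hφ in
lemma coeFn_adjoint_S_inv_S_inv {s : ℝ} (hs : 0 ≤ s) (f : L2) :
    ∀ᵐ x ∂halfLine, ContinuousLinearMap.adjoint (S hφ' hs) (S hφ' hs f) x
      = ((φ x / φ (x + s) : ℝ) : ℂ) * f x := by
  filter_upwards [coeFn_adjoint_S_inv hφ' hs (S hφ' hs f), ae_add hs (coeFn_S hφ' hs f),
    ae_nonneg] with x h1 h2 h0
  have p1 := hφ.pos x h0
  have p2 := hφ.pos (x + s) (by linarith)
  rw [h1, h2, translate, if_pos (by linarith), weight, if_pos (by linarith)]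
  simp only [add_sub_cancel_right]
  have e : φ⁻¹ (x + s) / φ⁻¹ x = φ x / φ (x + s) := by simp [div_eq_mul_inv, mul_comm]
  rw [e, ← mul_assoc, ← Complex.ofReal_mul, Real.mul_self_sqrt (by positivity)]

include hφ' in
-- The quotient is the multiplier of `L^n (L^n)*`, so the operator norm bounds it almost everywhere;
-- continuity extends this to every `x`. The test function is the indicator of a short interval `[x,
-- u)`, one-sided so that `x = 0` is allowed.
lemma div_le_norm_L_pow_sq (n : ℕ) {x : ℝ} (hx : 0 ≤ x) :
    φ x / φ (x + n * t) ≤ ‖L hφ ht ^ n‖ ^ 2 := by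
  have hnt : 0 ≤ n * t := by positivity
  by_contra! hlt
  obtain ⟨C, hC1, hC2⟩ := exists_between hlt
  have hcont : ContinuousOn (fun y => φ y / φ (y + n * t)) (Ici 0) := by
    refine hφ.continuousOn.div (hφ.continuousOn.comp (by fun_prop) fun y (hy : 0 ≤ y) =>
      add_nonneg hy hnt) fun y (hy : 0 ≤ y) => (hφ.pos _ (add_nonneg hy hnt)).ne'
  have hev : ∀ᶠ y in 𝓝[≥] x, C < φ y / φ (y + n * t) :=
    ((hcont x hx).mono (Ici_subset_Ici.2 hx)).eventually (lt_mem_nhds hC2)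
  obtain ⟨u, hu : x < u, hsub⟩ := (mem_nhdsGE_iff_exists_Ico_subset).1 hev
  have hμ : halfLine (Ico x u) ≠ ⊤ := (lt_of_le_of_lt (Measure.restrict_apply_le _ _) (by simp)).ne
  set h : L2 := indicatorConstLp 2 measurableSet_Ico hμ (1 : ℂ) with hh
  have hne : 0 < ‖h‖ := by
    rw [hh, norm_indicatorConstLp (by simp) (by simp), measureReal_def,
      Measure.restrict_apply measurableSet_Ico,
      inter_eq_left.2 (Ico_subset_Ici_self.trans (Ici_subset_Ici.2 hx)), Real.volume_Ico,
      ENNReal.toReal_ofReal (by linarith)]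
    rw [norm_one, one_mul]
    exact Real.rpow_pos_of_pos (sub_pos.2 hu) _
  have h1 : ‖(C : ℂ) • h‖ ≤ ‖ContinuousLinearMap.adjoint (S hφ' hnt) (S hφ' hnt h)‖ := by
    refine Lp.norm_le_norm_of_ae_le ?_
    filter_upwards [Lp.coeFn_smul (C : ℂ) h, coeFn_adjoint_S_inv_S_inv hφ hφ' hnt h,
      indicatorConstLp_coeFn (p := 2) (hs := measurableSet_Ico) (hμs := hμ) (c := (1 : ℂ))]
      with y h1 h2 h3
    rw [h1, h2, Pi.smul_apply, smul_eq_mul, norm_mul, norm_mul, hh, h3]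
    by_cases hy : y ∈ Ico x u
    · have hCy : C < φ y / φ (y + n * t) := hsub hy
      have hC0 : 0 ≤ C := (sq_nonneg _).trans hC1.le
      rw [Complex.norm_real, Complex.norm_real, Real.norm_of_nonneg hC0,
        Real.norm_of_nonneg (hC0.trans hCy.le)]
      gcongr
    · simp [hy]
  have h2 : ‖ContinuousLinearMap.adjoint (S hφ' hnt) (S hφ' hnt h)‖
      ≤ ‖L hφ ht ^ n‖ * (‖L hφ ht ^ n‖ * ‖h‖) := by
    have hn : ‖S hφ' hnt‖ = ‖L hφ ht ^ n‖ := by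
      rw [L_pow_eq hφ hφ' ht, LinearIsometryEquiv.norm_map]
    rw [← L_pow_eq hφ hφ' ht]
    refine (ContinuousLinearMap.le_opNorm _ _).trans ?_
    gcongr
    rw [← hn]
    exact ContinuousLinearMap.le_opNorm _ _
  rw [norm_smul, Complex.norm_real, Real.norm_of_nonneg ((sq_nonneg _).trans hC1.le)] at h1
  have h3 : C * ‖h‖ ≤ ‖L hφ ht ^ n‖ ^ 2 * ‖h‖ := by
    refine (h1.trans h2).trans_eq (by ring)
  exact absurd (le_of_mul_le_mul_right h3 hne) (not_le.2 hC1)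

include hφ' in
-- The bound `‖L^n‖²` splits into one factor for `z` and one for `w`, giving a product of terms of
-- two convergent series.
lemma summable_kernel (z w : disc hφ ht) {x : ℝ} (hx : 0 ≤ x) :
    Summable fun n : ℕ =>
      ((φ x / φ (x + n * t) : ℝ) : ℂ) * (z : ℂ) ^ n * conj (w : ℂ) ^ n := by
  have key : ∀ z : disc hφ ht, Summable fun n : ℕ => ‖L hφ ht ^ n‖ * ‖(z : ℂ)‖ ^ n := fun z => by
    have hz : ‖(z : ℂ)‖ₑ < (spectralRadius ℂ (L hφ ht))⁻¹ := z.2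
    exact summable_norm_pow_mul_pow (L hφ ht) (r := ‖(z : ℂ)‖₊) hz
  refine Summable.of_norm_bounded ((key w).mul_left (∑' n, ‖L hφ ht ^ n‖ * ‖(z : ℂ)‖ ^ n))
    fun n => ?_
  have p1 := hφ.pos x hx
  have p2 := hφ.pos (x + n * t) (by positivity)
  rw [norm_mul, norm_mul, Complex.norm_real, Real.norm_of_nonneg (by positivity), norm_pow,
    norm_pow, RCLike.norm_conj]
  calc φ x / φ (x + n * t) * ‖(z : ℂ)‖ ^ n * ‖(w : ℂ)‖ ^ n
      ≤ ‖L hφ ht ^ n‖ ^ 2 * ‖(z : ℂ)‖ ^ n * ‖(w : ℂ)‖ ^ n := by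
        gcongr; exact div_le_norm_L_pow_sq hφ hφ' ht n hx
    _ = (‖L hφ ht ^ n‖ * ‖(z : ℂ)‖ ^ n) * (‖L hφ ht ^ n‖ * ‖(w : ℂ)‖ ^ n) := by ring
    _ ≤ _ := by
        gcongr
        exact (key z).le_tsum n fun _ _ => by positivity

lemma inner_coeff (n : ℕ) (f : L2) (e : E hφ ht) :
    ⟪coeff hφ ht n f, e⟫_ℂ = ⟪f, S hφ' (mul_nonneg n.cast_nonneg ht) e⟫_ℂ := by
  rw [coeff, ContinuousLinearMap.comp_apply, Submodule.inner_orthogonalProjectionOnto_eq_of_mem_right,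
    L_pow_eq hφ hφ' ht, ContinuousLinearMap.adjoint_inner_left]

/-- Tested against `e'`, only a monomial in `w` survives, and `P_E L^n (L^n)*` is symmetric on `E`.
-/
lemma coeff_adjoint_evalAt (n : ℕ) (w : disc hφ ht) (e : E hφ ht) :
    coeff hφ ht n (ContinuousLinearMap.adjoint (evalAt hφ ht w) e)
      = conj (w : ℂ) ^ n • coeff hφ ht n (S hφ' (mul_nonneg n.cast_nonneg ht) e) := by
  refine ext_inner_right ℂ fun e' => ?_
  rw [inner_coeff hφ hφ' ht, ContinuousLinearMap.adjoint_inner_left,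
    evalAt_eq_of_forall_ne hφ ht w (fun m hm => coeff_S_of_ne hφ hφ' ht hφ' hm e')]
  have h : ⟪e, coeff hφ ht n (S hφ' (mul_nonneg n.cast_nonneg ht) e')⟫_ℂ
      = ⟪coeff hφ ht n (S hφ' (mul_nonneg n.cast_nonneg ht) e), e'⟫_ℂ := by
    rw [← inner_conj_symm e, inner_coeff hφ hφ' ht, inner_conj_symm, inner_coeff hφ hφ' ht]
  rw [← map_pow]
  exact inner_smul_eq_inner_conj_smul (V := E hφ ht) h

include hφ' in
lemma coeFn_evalAt_adjoint_evalAt (z w : disc hφ ht) (e : E hφ ht) :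
    ∀ᵐ x ∂halfLine, (evalAt hφ ht z (ContinuousLinearMap.adjoint (evalAt hφ ht w) e) : L2) x
      = (∑' n : ℕ, ((φ x / φ (x + n * t) : ℝ) : ℂ) * (z : ℂ) ^ n * conj (w : ℂ) ^ n) *
        (e : L2) x := by
  have h1 := (hasSum_evalAt hφ ht z (ContinuousLinearMap.adjoint (evalAt hφ ht w) e)).mapL
    (E hφ ht).subtypeL
  have h2 : ∀ n : ℕ, ∀ᵐ x ∂halfLine, (E hφ ht).subtypeL ((z : ℂ) ^ n • coeff hφ ht n
      (ContinuousLinearMap.adjoint (evalAt hφ ht w) e)) x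
      = ((φ x / φ (x + n * t) : ℝ) : ℂ) * (z : ℂ) ^ n * conj (w : ℂ) ^ n * (e : L2) x := by
    intro n
    have hnt : 0 ≤ n * t := by positivity
    set g := S hφ' hnt e
    have h3 : (E hφ ht).subtypeL ((z : ℂ) ^ n • coeff hφ ht n
      (ContinuousLinearMap.adjoint (evalAt hφ ht w) e))
      = ((z : ℂ) ^ n * conj (w : ℂ) ^ n) • (coeff hφ ht n g : L2) := by
      rw [coeff_adjoint_evalAt hφ hφ' ht, smul_smul]
      rfl
    rw [h3]
    have h4 := coeFn_orthogonalProjection_E hφ ht ((L hφ ht ^ n) g)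
    have h5 := coeFn_adjoint_S_inv_S_inv hφ hφ' hnt e
    rw [← L_pow_eq hφ hφ' ht] at h5
    filter_upwards [Lp.coeFn_smul ((z : ℂ) ^ n * conj (w : ℂ) ^ n) (coeff hφ ht n g : L2), h4, h5,
      (mem_E_iff hφ ht e).1 e.2] with x h3 h4 h5 h6
    rw [h3, Pi.smul_apply, coeff, ContinuousLinearMap.comp_apply, h4, smul_eq_mul]
    -- Beyond `t` the projection vanishes on the left and `e` on the right.
    split_ifs with hx
    · rw [h5]; ring
    · rw [h6 (not_lt.1 hx)]; simp
  filter_upwards [ae_eq_tsum_of_hasSum h1 h2 (by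
    filter_upwards [ae_nonneg] with x hx
    exact (summable_kernel hφ hφ' ht z w hx).mul_right _)] with x hx
  rw [← tsum_mul_right]
  exact hx

end

/-! ### Haar systems of abstract dyadic families. -/

section DyadicSystem

variable {H : Type*} [NormedAddCommGroup H] [InnerProductSpace ℂ H]

/-- A family indexed like the indicator functions of the dyadic intervals of the half line: each
vector is the sum of its two children, and vectors of the same generation are orthogonal. -/
structure IsDyadic (D : ℤ → ℕ → H) : Prop where
  split : ∀ j k, D j k = D (j + 1) (2 * k) + D (j + 1) (2 * k + 1)
  inner_eq : ∀ j k k', ⟪D j k, D j k'⟫_ℂ = if k = k' then (2 : ℂ) ^ (-j) else 0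

/-- The Haar system of a dyadic family. -/
noncomputable def haarVec (D : ℤ → ℕ → H) (p : ℤ × ℕ) : H :=
  (((2 : ℝ) ^ ((p.1 : ℝ) / 2) : ℝ) : ℂ) • (D (p.1 + 1) (2 * p.2) - D (p.1 + 1) (2 * p.2 + 1))

variable {D : ℤ → ℕ → H} (hD : IsDyadic D)

include hD

/-- In one generation this holds because siblings have equal norms; a coarser vector is the sum of
its two children. -/
lemma IsDyadic.inner_haarVec_add (m : ℕ) (j : ℤ) (k k' : ℕ) :
    ⟪D j k, haarVec D (j + m, k')⟫_ℂ = 0 := by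
  induction m generalizing j k with
  | zero =>
    rw [hD.split, haarVec, inner_smul_right, inner_sub_right, inner_add_left, inner_add_left]
    simp only [hD.inner_eq, Nat.cast_zero, add_zero]
    by_cases h : k = k'
    · subst h; simp
    · have h1 : 2 * k ≠ 2 * k' := by omega
      have h2 : 2 * k ≠ 2 * k' + 1 := by omega
      have h3 : 2 * k + 1 ≠ 2 * k' := by omega
      simp [h1, h2, h3]
  | succ m ih =>
    have e : j + (m + 1 : ℕ) = j + 1 + m := by push_cast; ring
    rw [hD.split, inner_add_left, e, ih, ih, add_zero]

lemma IsDyadic.inner_haarVec_of_lt {j j' : ℤ} (h : j < j') (k k' : ℕ) :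
    ⟪haarVec D (j, k), haarVec D (j', k')⟫_ℂ = 0 := by
  obtain ⟨m, rfl⟩ : ∃ m : ℕ, j' = j + 1 + m := ⟨(j' - (j + 1)).toNat, by omega⟩
  rw [haarVec, inner_smul_left, inner_sub_left]
  simp only [hD.inner_haarVec_add, sub_zero, mul_zero]

lemma IsDyadic.orthonormal_haarVec : Orthonormal ℂ (haarVec D) := by
  rw [orthonormal_iff_ite]
  rintro ⟨j, k⟩ ⟨j', k'⟩
  rcases lt_trichotomy j j' with h | rfl | h
  · rw [hD.inner_haarVec_of_lt h, if_neg (by simp [h.ne])]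
  · rw [haarVec, haarVec, inner_smul_left, inner_smul_right, inner_sub_left, inner_sub_right,
      inner_sub_right]
    simp only [hD.inner_eq]
    by_cases h : k = k'
    · subst h
      have e : ((2 : ℝ) ^ ((j : ℝ) / 2)) * ((2 : ℝ) ^ ((j : ℝ) / 2)) = (2 : ℝ) ^ j := by
        rw [← Real.rpow_add two_pos, add_halves, Real.rpow_intCast]
      have e' : (((2 : ℝ) ^ ((j : ℝ) / 2) : ℝ) : ℂ) * (((2 : ℝ) ^ ((j : ℝ) / 2) : ℝ) : ℂ)
          = (2 : ℂ) ^ j := by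
        rw [← Complex.ofReal_mul, e]; push_cast; rfl
      have hne : (2 : ℂ) ^ j ≠ 0 := zpow_ne_zero _ two_ne_zero
      simp only [Complex.conj_ofReal, if_true]
      rw [← mul_assoc, e', zpow_neg, zpow_add₀ two_ne_zero]
      simp
      field_simp
      norm_num
    · have h1 : 2 * k ≠ 2 * k' := by omega
      have h2 : 2 * k ≠ 2 * k' + 1 := by omega
      have h3 : 2 * k + 1 ≠ 2 * k' := by omega
      simp [h1, h2, h3, h]
  · rw [← inner_conj_symm, hD.inner_haarVec_of_lt h, if_neg (by simp [h.ne']), map_zero]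

lemma IsDyadic.norm_sq (j : ℤ) (k : ℕ) : ‖D j k‖ ^ 2 = (2 : ℝ) ^ (-j) := by
  have h := hD.inner_eq j k k
  rw [if_pos rfl, inner_self_eq_norm_sq_to_K] at h
  have : ((‖D j k‖ ^ 2 : ℝ) : ℂ) = (((2 : ℝ) ^ (-j) : ℝ) : ℂ) := by
    push_cast; exact h
  exact_mod_cast this

/-- Orthogonality to the Haar vector makes siblings have equal products with `f`, so each has half
that of the parent, whose index is `k / 2`. -/
lemma IsDyadic.inner_succ {f : H} (hf : ∀ p, ⟪haarVec D p, f⟫_ℂ = 0) (j : ℤ) (k : ℕ) :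
    ⟪D (j + 1) k, f⟫_ℂ = 2⁻¹ * ⟪D j (k / 2), f⟫_ℂ := by
  have h1 := hf (j, k / 2)
  have h2 : (((2 : ℝ) ^ ((j : ℝ) / 2) : ℝ) : ℂ) ≠ 0 :=
    Complex.ofReal_ne_zero.2 (Real.rpow_pos_of_pos two_pos _).ne'
  rw [haarVec, inner_smul_left, Complex.conj_ofReal, inner_sub_left] at h1
  have h3 := sub_eq_zero.1 ((mul_eq_zero.1 h1).resolve_left h2)
  rw [hD.split j, inner_add_left]
  dsimp only at h3
  rcases Nat.even_or_odd' k with ⟨l, rfl | rfl⟩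
  · rw [Nat.mul_div_cancel_left _ two_pos] at h3 ⊢
    rw [← h3]; ring
  · have : (2 * l + 1) / 2 = l := by omega
    rw [this] at h3 ⊢
    rw [h3]; ring

/-- Ascending `m` generations gains `4^{-m}`, while the squared norm of the ancestor grows only by
`2^m`; Cauchy–Schwarz leaves `2^{-m}`. -/
lemma IsDyadic.norm_inner_sq_le {f : H} (hf : ∀ p, ⟪haarVec D p, f⟫_ℂ = 0) (m : ℕ) (j : ℤ)
    (k : ℕ) : ‖⟪D j k, f⟫_ℂ‖ ^ 2 ≤ (2⁻¹ : ℝ) ^ m * ((2 : ℝ) ^ (-j) * ‖f‖ ^ 2) := by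
  induction m generalizing j k with
  | zero =>
    rw [pow_zero, one_mul, ← hD.norm_sq j k, ← mul_pow]
    gcongr
    exact norm_inner_le_norm _ _
  | succ m ih =>
    obtain ⟨i, rfl⟩ : ∃ i, j = i + 1 := ⟨j - 1, by ring⟩
    rw [hD.inner_succ hf, norm_mul, mul_pow]
    calc ‖(2⁻¹ : ℂ)‖ ^ 2 * ‖⟪D i (k / 2), f⟫_ℂ‖ ^ 2
        ≤ ‖(2⁻¹ : ℂ)‖ ^ 2 * ((2⁻¹ : ℝ) ^ m * ((2 : ℝ) ^ (-i) * ‖f‖ ^ 2)) := by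
          gcongr; exact ih i _
      _ = _ := by
        rw [neg_add, zpow_add₀ two_ne_zero, norm_inv, Complex.norm_ofNat, pow_succ, zpow_neg_one]
        ring

/-- A vector orthogonal to the Haar system is orthogonal to the dyadic family. -/
lemma IsDyadic.inner_eq_zero {f : H} (hf : ∀ p, ⟪haarVec D p, f⟫_ℂ = 0) (j : ℤ) (k : ℕ) :
    ⟪D j k, f⟫_ℂ = 0 := by
  have h1 : Tendsto (fun m : ℕ => (2⁻¹ : ℝ) ^ m * ((2 : ℝ) ^ (-j) * ‖f‖ ^ 2)) atTop (𝓝 0) := by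
    simpa using (tendsto_pow_atTop_nhds_zero_of_lt_one (by norm_num : (0 : ℝ) ≤ 2⁻¹)
      (by norm_num)).mul_const ((2 : ℝ) ^ (-j) * ‖f‖ ^ 2)
  have h2 := ge_of_tendsto' h1 fun m => hD.norm_inner_sq_le hf m j k
  have h3 : ‖⟪D j k, f⟫_ℂ‖ ^ 2 = 0 := le_antisymm h2 (sq_nonneg _)
  simpa using h3

end DyadicSystem

/-! ### Dyadic indicators and the Haar basis of the half line. -/

/-- The dyadic interval `[k 2^{-j}, (k + 1) 2^{-j})`. -/
def dyadicInterval (j : ℤ) (k : ℕ) : Set ℝ := Ico (k / (2 : ℝ) ^ j) ((k + 1) / (2 : ℝ) ^ j)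

lemma mem_dyadicInterval {j : ℤ} {k : ℕ} {x : ℝ} :
    x ∈ dyadicInterval j k ↔ (k : ℝ) ≤ 2 ^ j * x ∧ 2 ^ j * x < k + 1 := by
  have h : (0 : ℝ) < 2 ^ j := by positivity
  rw [dyadicInterval, mem_Ico, div_le_iff₀' h, lt_div_iff₀' h]

lemma measurableSet_dyadicInterval (j : ℤ) (k : ℕ) : MeasurableSet (dyadicInterval j k) :=
  measurableSet_Ico

lemma halfLine_dyadicInterval (j : ℤ) (k : ℕ) :
    halfLine (dyadicInterval j k) = ENNReal.ofReal (2 ^ (-j)) := by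
  have h : dyadicInterval j k ⊆ Ici 0 :=
    Ico_subset_Ici_self.trans (Ici_subset_Ici.2 (by positivity))
  rw [Measure.restrict_apply (measurableSet_dyadicInterval j k), inter_eq_left.2 h,
    dyadicInterval, Real.volume_Ico, ← sub_div, add_sub_cancel_left, one_div, zpow_neg]

lemma halfLine_dyadicInterval_ne_top (j : ℤ) (k : ℕ) : halfLine (dyadicInterval j k) ≠ ⊤ := by
  rw [halfLine_dyadicInterval]; exact ENNReal.ofReal_ne_top

/-- The indicator functions of the dyadic intervals. -/
noncomputable def dyadicIndicator (j : ℤ) (k : ℕ) : L2 :=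
  indicatorConstLp 2 (measurableSet_dyadicInterval j k) (halfLine_dyadicInterval_ne_top j k) (1 : ℂ)

lemma coeFn_dyadicIndicator (j : ℤ) (k : ℕ) :
    ∀ᵐ x ∂halfLine, dyadicIndicator j k x = (dyadicInterval j k).indicator (fun _ => 1) x :=
  indicatorConstLp_coeFn

lemma isDyadic_dyadicIndicator : IsDyadic dyadicIndicator where
  split j k := by
    refine Lp.ext ?_
    filter_upwards [coeFn_dyadicIndicator j k, coeFn_dyadicIndicator (j + 1) (2 * k),
      coeFn_dyadicIndicator (j + 1) (2 * k + 1),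
      Lp.coeFn_add (dyadicIndicator (j + 1) (2 * k)) (dyadicIndicator (j + 1) (2 * k + 1))]
      with x h1 h2 h3 h4
    rw [h4, Pi.add_apply, h1, h2, h3]
    simp only [indicator, mem_dyadicInterval, zpow_add_one₀ (two_ne_zero (α := ℝ))]
    push_cast
    by_cases hk : (k : ℝ) ≤ 2 ^ j * x ∧ 2 ^ j * x < k + 1
    · rw [if_pos hk]
      by_cases hm : (2 : ℝ) ^ j * 2 * x < 2 * k + 1
      · rw [if_pos ⟨by linarith, hm⟩, if_neg (by rintro ⟨h, -⟩; linarith), add_zero]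
      · rw [if_neg fun h => hm h.2, if_pos ⟨by linarith, by linarith⟩, zero_add]
    · rw [if_neg hk, if_neg, if_neg, add_zero]
      · rintro ⟨h1, h2⟩; exact hk ⟨by linarith, by linarith⟩
      · rintro ⟨h1, h2⟩; exact hk ⟨by linarith, by linarith⟩
  inner_eq j k k' := by
    rw [dyadicIndicator, dyadicIndicator, L2.inner_indicatorConstLp_indicatorConstLp _ _
      (halfLine_dyadicInterval_ne_top j k) (halfLine_dyadicInterval_ne_top j k')]
    by_cases h : k = k'
    · subst h
      rw [inter_self, measureReal_def, halfLine_dyadicInterval,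
        ENNReal.toReal_ofReal (by positivity)]
      simp
    · have : dyadicInterval j k ∩ dyadicInterval j k' = ∅ := by
        ext x
        simp only [mem_inter_iff, mem_dyadicInterval, mem_empty_iff_false, iff_false]
        rintro ⟨⟨h1, h2⟩, h3, h4⟩
        have h5 : (k : ℝ) < k' + 1 := by linarith
        have h6 : (k' : ℝ) < k + 1 := by linarith
        norm_cast at h5 h6
        omega
      rw [this]
      simp [h]

/-- The primitive of `f` vanishes at dyadic points, hence everywhere by continuity, and Lebesgue
differentiation recovers `f`. -/
lemma eq_zero_of_inner_dyadicIndicator {f : L2} (hf : ∀ j k, ⟪dyadicIndicator j k, f⟫_ℂ = 0) :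
    f = 0 := by
  set f₀ : ℝ → ℂ := (Ici 0).indicator f with hf₀
  have hmem : MemLp f₀ 2 volume := (memLp_indicator_iff_restrict measurableSet_Ici).2 (Lp.memLp f)
  have hloc : LocallyIntegrable f₀ volume := hmem.locallyIntegrable (by norm_num)
  have hint : ∀ a b, IntervalIntegrable f₀ volume a b := fun a b =>
    (hloc.integrableOn_isCompact isCompact_uIcc).intervalIntegrable
  have hstep : ∀ (j : ℤ) (k : ℕ),
      ∫ x in (k / (2 : ℝ) ^ j)..((k + 1) / (2 : ℝ) ^ j), f₀ x = 0 := by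
    intro j k
    have h1 := hf j k
    rw [dyadicIndicator, L2.inner_indicatorConstLp_one] at h1
    rw [intervalIntegral.integral_of_le (by gcongr; linarith), ← integral_Ico_eq_integral_Ioc]
    change ∫ x in dyadicInterval j k, f₀ x = 0
    have h : dyadicInterval j k ⊆ Ici 0 :=
      Ico_subset_Ici_self.trans (Ici_subset_Ici.2 (by positivity))
    rw [← h1, Measure.restrict_restrict (measurableSet_dyadicInterval j k), inter_eq_left.2 h]
    refine setIntegral_congr_fun (measurableSet_dyadicInterval j k) fun x hx => ?_
    exact indicator_of_mem (h hx) _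
  have hdy : ∀ (j : ℤ) (k : ℕ), ∫ x in (0 : ℝ)..(k / (2 : ℝ) ^ j), f₀ x = 0 := by
    intro j k
    induction k with
    | zero => simp
    | succ k ih =>
      have h := hstep j k
      push_cast
      rw [← intervalIntegral.integral_add_adjacent_intervals (hint 0 (k / (2 : ℝ) ^ j)) (hint _ _),
        ih, h, add_zero]
  have hall : ∀ y, 0 ≤ y → ∫ x in (0 : ℝ)..y, f₀ x = 0 := by
    intro y hy
    have h1 : Tendsto (fun n : ℕ => (⌊y * (2 : ℝ) ^ n⌋₊ : ℝ) / (2 : ℝ) ^ n) atTop (𝓝 y) :=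
      (tendsto_nat_floor_mul_div_atTop hy).comp
        (tendsto_pow_atTop_atTop_of_one_lt (one_lt_two (α := ℝ)))
    have h2 := ((intervalIntegral.continuous_primitive hint 0).tendsto y).comp h1
    refine tendsto_nhds_unique h2 (tendsto_const_nhds.congr fun n => ?_)
    exact (hdy n _).symm
  -- At `0` the primitive is controlled only from the right, so that point is discarded.
  have hne : ∀ᵐ x : ℝ, x ≠ 0 := Measure.ae_ne volume 0
  rw [Lp.eq_zero_iff_ae_eq_zero]
  filter_upwards [ae_restrict_of_ae (_root_.LocallyIntegrable.ae_hasDerivAt_integral hloc),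
    ae_restrict_of_ae hne, ae_nonneg] with x h1 h2 h0
  have hx : 0 < x := lt_of_le_of_ne h0 (Ne.symm h2)
  have h3 : HasDerivAt (fun y => ∫ x in (0 : ℝ)..y, f₀ x) 0 x := by
    refine (hasDerivAt_const x (0 : ℂ)).congr_of_eventuallyEq ?_
    filter_upwards [lt_mem_nhds hx] with y hy
    exact hall y hy.le
  have h4 := (h1 0).unique h3
  rwa [hf₀, indicator_of_mem (show x ∈ Ici 0 from h0)] at h4

/-- The Haar system is a Hilbert basis of `L²(ℝ₊)`. -/
noncomputable def haarBasis : HilbertBasis (ℤ × ℕ) ℂ L2 :=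
  HilbertBasis.mkOfOrthogonalEqBot isDyadic_dyadicIndicator.orthonormal_haarVec (by
    refine (Submodule.eq_bot_iff _).2 fun f hf => ?_
    refine eq_zero_of_inner_dyadicIndicator (isDyadic_dyadicIndicator.inner_eq_zero fun p => ?_)
    exact Submodule.inner_right_of_mem_orthogonal (Submodule.subset_span (mem_range_self p)) hf)

lemma coeFn_haarBasis (j : ℤ) (k : ℕ) :
    ∀ᵐ x ∂halfLine, haarBasis (j, k) x = ((haar j k x : ℝ) : ℂ) := by
  rw [haarBasis, HilbertBasis.coe_mkOfOrthogonalEqBot, haarVec]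
  filter_upwards [coeFn_dyadicIndicator (j + 1) (2 * k), coeFn_dyadicIndicator (j + 1) (2 * k + 1),
    Lp.coeFn_smul (((2 : ℝ) ^ ((j : ℝ) / 2) : ℝ) : ℂ)
      (dyadicIndicator (j + 1) (2 * k) - dyadicIndicator (j + 1) (2 * k + 1)),
    Lp.coeFn_sub (dyadicIndicator (j + 1) (2 * k)) (dyadicIndicator (j + 1) (2 * k + 1))]
    with x h1 h2 h3 h4
  rw [h3, Pi.smul_apply, h4, Pi.sub_apply, h1, h2, haar, smul_eq_mul, Complex.ofReal_mul]
  congr 1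
  simp only [haarMother, indicator, mem_dyadicInterval, zpow_add_one₀ (two_ne_zero (α := ℝ))]
  push_cast
  by_cases ha : 0 ≤ (2 : ℝ) ^ j * x - k ∧ (2 : ℝ) ^ j * x - k < 1 / 2
  · rw [if_pos ha, if_pos ⟨by linarith, by linarith⟩, if_neg (by rintro ⟨h, -⟩; linarith)]
    simp
  · rw [if_neg ha, if_neg (by rintro ⟨h, h'⟩; exact ha ⟨by linarith, by linarith⟩)]
    by_cases hb : 1 / 2 ≤ (2 : ℝ) ^ j * x - k ∧ (2 : ℝ) ^ j * x - k < 1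
    · rw [if_pos hb, if_pos ⟨by linarith, by linarith⟩]
      simp
    · rw [if_neg hb, if_neg (by rintro ⟨h, h'⟩; exact hb ⟨by linarith, by linarith⟩)]
      simp

lemma haar_eq_zero {j : ℤ} {k : ℕ} {x : ℝ} (hx : (k + 1) / (2 : ℝ) ^ j ≤ x) : haar j k x = 0 := by
  have h : (0 : ℝ) < 2 ^ j := by positivity
  rw [div_le_iff₀' h] at hx
  rw [haar, haarMother, if_neg (by rintro ⟨_, _⟩; linarith), if_neg (by rintro ⟨_, _⟩; linarith),
    mul_zero]

lemma isPoly_evalAt_haarBasis {φ : ℝ → ℝ} (hφ : IsSymbol φ) (hφ' : IsSymbol φ⁻¹) {t : ℝ}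
    (ht : 0 < t) (p : ℤ × ℕ) :
    IsPoly fun z : disc hφ ht.le => evalAt hφ ht.le z (haarBasis p) := by
  obtain ⟨j, k⟩ := p
  -- From this index on, blocks lie to the right of the support `[k 2^{-j}, (k + 1) 2^{-j})`.
  refine isPoly_evalAt hφ ht.le (N := ⌈(k + 1) / (2 : ℝ) ^ j / t⌉₊) fun n hn => ?_
  rw [coeff_eq_zero_iff hφ hφ']
  filter_upwards [coeFn_haarBasis j k] with x hx h1 _
  rw [hx, haar_eq_zero, Complex.ofReal_zero]
  exact ((div_le_iff₀ ht).1 (Nat.ceil_le.1 hn)).trans h1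

/-! ### The reproducing kernel Hilbert space and the theorem. -/

section

variable {φ : ℝ → ℝ} (hφ : IsSymbol φ) (hφ' : IsSymbol φ⁻¹) {t : ℝ} (ht : 0 < t)

/-- `L²(ℝ₊)` as a reproducing kernel Hilbert space of `E`-valued functions on the disc: the
function attached to `f` has the Taylor coefficients `P_E L_t^n f`. -/
@[reducible]
noncomputable def modelRKHS : RKHS ℂ L2 (disc hφ ht.le) (E hφ ht.le) where
  coeCLM := ContinuousLinearMap.pi fun z => evalAt hφ ht.le z
  coeCLM_injective := by
    refine (injective_iff_map_eq_zero _).2 fun f hf => ?_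
    exact eq_zero_of_evalAt_eq_zero hφ hφ' ht fun z => congrFun hf z

lemma kernel_modelRKHS (z w : disc hφ ht.le) (e : E hφ ht.le) :
    (letI := modelRKHS hφ hφ' ht; RKHS.kernel L2 z w e)
      = evalAt hφ ht.le z (ContinuousLinearMap.adjoint (evalAt hφ ht.le w) e) := by
  let := modelRKHS hφ hφ' ht
  exact (RKHS.kerFun_apply L2 w e z).symm

include hφ' in
lemma dense_isPoly_evalAt :
    Dense {f : L2 | IsPoly fun z : disc hφ ht.le => evalAt hφ ht.le z f} := by
  let V : Submodule ℂ L2 :=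
    { carrier := {f : L2 | IsPoly fun z : disc hφ ht.le => evalAt hφ ht.le z f}
      zero_mem' := ⟨0, fun z => by simp⟩
      add_mem' := by
        rintro f g ⟨p, hp⟩ ⟨q, hq⟩
        exact ⟨p + q, fun z => by
          rw [map_add, ← hp z, ← hq z]
          exact map_add _ f g⟩
      smul_mem' := by
        rintro c f ⟨p, hp⟩
        exact ⟨c • p, fun z => by
          rw [map_smul, ← hp z]
          exact map_smul _ c f⟩ }
  have h1 : Submodule.span ℂ (range haarBasis) ≤ V := by
    rw [Submodule.span_le]
    rintro _ ⟨p, rfl⟩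
    exact isPoly_evalAt_haarBasis hφ hφ' ht p
  have h2 : Dense (Submodule.span ℂ (range haarBasis) : Set L2) :=
    Submodule.dense_iff_topologicalClosure_eq_top.2 haarBasis.dense_span
  exact h2.mono h1

end

end WTS

theorem theorem3p5 (φ : ℝ → ℝ) (hφ : WTS.IsSymbol φ)
    (hinf : ∀ s : ℝ, 0 ≤ s → 0 < ⨅ x : Set.Ici (0 : ℝ), φ (x + s) / φ x)
    (t : ℝ) (ht : 0 < t) :
    WTS.LeftInvertible (WTS.S hφ ht.le) ∧
    ∃ (H : Type) (_ : NormedAddCommGroup H) (_ : InnerProductSpace ℂ H) (_ : CompleteSpace H)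
      (_ : RKHS ℂ H (WTS.disc hφ ht.le) (WTS.E hφ ht.le))
      (Mz : H →L[ℂ] H) (U : WTS.L2 ≃ₗᵢ[ℂ] H),
      -- the elements of `H` are analytic functions
      (∀ h : H, WTS.IsAnalytic (h : WTS.disc hφ ht.le → WTS.E hφ ht.le)) ∧
      -- `Mz` is multiplication by `z`, and `U` intertwines `S_t` with it
      (∀ (h : H) (z : WTS.disc hφ ht.le), (Mz h) z = (z : ℂ) • h z) ∧
      (∀ f : WTS.L2, Mz (U f) = U (WTS.S hφ ht.le f)) ∧
      -- `U` maps `E` onto the constant functions, with `(U e)(z) = e`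
      (∀ (e : WTS.E hφ ht.le) (z : WTS.disc hφ ht.le), (U (e : WTS.L2)) z = e) ∧
      (U '' (WTS.E hφ ht.le : Set WTS.L2) =
        {h : H | ∃ c : WTS.E hφ ht.le, ∀ z : WTS.disc hφ ht.le, h z = c}) ∧
      -- the reproducing property of the kernel
      (∀ (e : WTS.E hφ ht.le) (w : WTS.disc hφ ht.le), ∃ h : H,
        (∀ z : WTS.disc hφ ht.le, h z = RKHS.kernel H z w e) ∧
        ∀ f : WTS.L2, ⟪e, (U f) w⟫_ℂ = ⟪h, U f⟫_ℂ) ∧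
      -- the kernel is diagonal
      (∀ z w : WTS.disc hφ ht.le,
        (∀ x : ℝ, 0 ≤ x → Summable fun n : ℕ =>
          ((φ x / φ (x + n * t) : ℝ) : ℂ) * (z : ℂ) ^ n * conj (w : ℂ) ^ n) ∧
        ∀ e : WTS.E hφ ht.le, ∀ᵐ x ∂WTS.halfLine,
          ((RKHS.kernel H z w e : WTS.E hφ ht.le) : WTS.L2) x =
            (∑' n : ℕ, ((φ x / φ (x + n * t) : ℝ) : ℂ) * (z : ℂ) ^ n * conj (w : ℂ) ^ n) *
              (e : WTS.L2) x) ∧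
      -- the `E`-valued polynomials belong to `H` and are dense in it
      (∀ p : PolynomialModule ℂ (WTS.E hφ ht.le), ∃ h : H,
        ∀ z : WTS.disc hφ ht.le, h z = PolynomialModule.eval (z : ℂ) p) ∧
      Dense {h : H | WTS.IsPoly (h : WTS.disc hφ ht.le → WTS.E hφ ht.le)} ∧
      -- the images of the Haar functions form an orthonormal basis of polynomials
      ∃ b : HilbertBasis (ℤ × ℕ) ℂ H, ∀ (j : ℤ) (k : ℕ),
        WTS.IsPoly (b (j, k) : WTS.disc hφ ht.le → WTS.E hφ ht.le) ∧
        U.symm (b (j, k)) =ᵐ[WTS.halfLine] fun x => ((WTS.haar j k x : ℝ) : ℂ) := by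
  have hφ' := hφ.inv hinf
  refine ⟨WTS.leftInvertible_S hφ hφ' ht.le, WTS.L2, inferInstance, inferInstance, inferInstance,
    WTS.modelRKHS hφ hφ' ht, WTS.S hφ ht.le, LinearIsometryEquiv.refl ℂ WTS.L2,
    WTS.isAnalytic_evalAt hφ ht.le, fun f z => WTS.evalAt_S hφ hφ' ht.le z f, fun _ => rfl,
    fun e z => WTS.evalAt_mem hφ hφ' ht.le z e, ?_, ?_, ?_,
    WTS.exists_evalAt_eq_eval hφ hφ' ht.le, WTS.dense_isPoly_evalAt hφ hφ' ht,
    WTS.haarBasis, fun j k =>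
      ⟨WTS.isPoly_evalAt_haarBasis hφ hφ' ht (j, k), WTS.coeFn_haarBasis j k⟩⟩
  · refine (Set.image_id _).trans (Set.ext fun f => ⟨fun hf => ⟨⟨f, hf⟩, fun z =>
      WTS.evalAt_mem hφ hφ' ht.le z ⟨f, hf⟩⟩, ?_⟩)
    rintro ⟨c, hc⟩
    -- The vector `c` of `E` also has the constant `c` as its function, so injectivity of the model
    -- forces `f = c`.
    have h : f - c = 0 := WTS.eq_zero_of_evalAt_eq_zero hφ hφ' ht fun z => by
      rw [map_sub, WTS.evalAt_mem hφ hφ' ht.le, sub_eq_zero]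
      exact hc z
    rw [sub_eq_zero.1 h]
    exact c.2
  · intro e w
    refine ⟨ContinuousLinearMap.adjoint (WTS.evalAt hφ ht.le w) e, fun z =>
      (WTS.kernel_modelRKHS hφ hφ' ht z w e).symm, fun f => ?_⟩
    exact (ContinuousLinearMap.adjoint_inner_left (WTS.evalAt hφ ht.le w) f e).symm
  · intro z w
    refine ⟨fun x hx => WTS.summable_kernel hφ hφ' ht.le z w hx, fun e => ?_⟩
    rw [WTS.kernel_modelRKHS hφ hφ' ht]
    exact WTS.coeFn_evalAt_adjoint_evalAt hφ hφ' ht.le z w e
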